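/- **Theorem (All perfect strategies collapse CC).** Let $\mathcal G,\mathcal H$ be finite simple graphs, with disjoint vertex sets, such that the following hold. 1. $\mathcal G\cong_{ns}\mathcal H$, i.e. there is a perfect non-signalling strategy for the isomorphism game of $(\mathcal G,\mathcal H)$ (defined below). 2. $\operatorname{diam}(\mathcal G)\ge 2$, where $\operatorname{diam}(\mathcal G)$ is the largest distance between two vertices lying in the same connected component of $\mathcal G$. 3. $\mathcal H$ is not connected: $V(\mathcal H)=\mathcal H_1\sqcup\mathcal H_2$ with $\mathcal H_1,\mathcal H_2$ nonempty and no edge between them (each may consist of several components). 4. There are partitions $V(\mathcal G)=C_1\sqcup\dots\sqcup C_k$ and $V(\mathcal H)=D_1\sqcup\dots\sqcup D_k$ into nonempty cells forming a common equitable partition: $|C_i|=|D_i|$ for all $i$, and there are integers $c_{ij}$ such that every vertex of $C_i$ has exactly $c_{ij}$ neighbours in $C_j$ and every vertex of $D_i$ has exactly $c_{ij}$ neighbours in $D_j$. Moreover $$\frac{|D_i\cap\mathcal H_1|}{|D_i|}=\frac{|D_j\cap\mathcal H_1|}{|D_j|}\qquad\text{for all } i,j .$$ 5. $\mathcal H$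 is $d$-regular for some $d$. 6. $\mathcal H$ is strongly transitive: there are a set $S\subseteq\operatorname{Aut}(\mathcal H)$ and constants $d_1,d_2,d_3\ge1$ such that for all vertices $h,h'$ exactly $d_1$ elements $\varphi\in S$ satisfy $\varphi(h)=h'$; for all $h_1\sim h_2$ and $h_1'\sim h_2'$ in $\mathcal H$ exactly $d_2$ elements $\varphi\in S$ satisfy $\varphi(h_1)=h_1'$, $\varphi(h_2)=h_2'$; and for all $h_1\sim h_2$ and $h_1'\sim h_2'$ in the complement graph $\mathcal H^c$ exactly $d_3$ elements $\varphi\in S$ satisfy $\varphi(h_1)=h_1'$, $\varphi(h_2)=h_2'$. Then *every* perfect non-signalling strategy for the isomorphism game of $(\mathcal G,\mathcal H)$, assisted by shared randomness, collapses communication complexity. *Definitions.* Put $V=V(\mathcal G)\sqcup V(\mathcal H)$. A non-signalling strategy is a family of probability distributions $\mathtt P(y_A,y_B\mid x_A,x_B)$ on $V\times V$, indexed by $(x_A,x_B)\in V\times V$, whose $y_A$-marginal does not depend on $x_B$ and whose $y_B$-marginal does not depend on $x_A$. In the isomorphism game, questions $x_A,x_B$ and answers $y_A,y_B$ win if exactly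 one of $x_A,y_A$ is a vertex of $\mathcal G$ (call it $g_A$, and the other one, in $V(\mathcal H)$, $h_A$), likewise for $x_B,y_B$ (giving $g_B,h_B$), and $g_A=g_B\Leftrightarrow h_A=h_B$, $g_A\sim g_B\Leftrightarrow h_A\sim h_B$, $g_A\not\simeq g_B\Leftrightarrow h_A\not\simeq h_B$, where $\not\simeq$ means neither equal nor adjacent. The strategy is perfect if, for all questions, it wins with probability $1$. A strategy $\mathtt P$ *collapses communication complexity* if there is $p>\frac12$ such that for all $n,m\ge 0$ and every $f:\{0,1\}^n\times\{0,1\}^m\to\{0,1\}$ there is a protocol of the following kind which, on all inputs $(X,Y)$, makes Alice output $f(X,Y)$ with probability at least $p$. Alice is given $X$ and Bob is given $Y$; they share a random variable with finitely many values and finitely many independent copies of $\mathtt P$, of which each party uses her or his side of every copy exactly once, choosing adaptively the order of the copies and the questions; Bob sends a single bit to Alice (depending on $Y$, the shared randomness and his answers), and Alice outputs a bit (her questions and her output may depend on $X$, the shared randomness, her earlier answers and the bit received). -/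

import Mathlib

namespace GraphIsoGame

/-! ### Bipartite boxes -/

/-- A bipartite box with question set `Q` and answer set `A` for both parties:
`P xA xB yA yB` stands for `P(yA, yB | xA, xB)`. -/
abbrev Box (Q A : Type*) := Q → Q → A → A → ℝ

/-- `P` is a non-signalling conditional probability distribution. -/
structure IsNonSignalling {Q A : Type*} [Fintype A] (P : Box Q A) : Prop where
  nonneg : ∀ xA xB yA yB, 0 ≤ P xA xB yA yB
  sum_eq_one : ∀ xA xB, ∑ yA, ∑ yB, P xA xB yA yB = 1
  alice_marginal : ∀ xA xB xB' yA, ∑ yB, P xA xB yA yB = ∑ yB, P xA xB' yA yB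
  bob_marginal : ∀ xA xA' xB yB, ∑ yA, P xA xB yA yB = ∑ yA, P xA' xB yA yB

/-! ### Communication complexity with shared copies of a box -/

/-- How one party uses her halves of `N` copies of a box, each of them exactly once.
The argument `ω` lists the answers she gets, in the order in which she uses the copies:
at time `t` she uses copy `copy ω t`, with question `question ω t`, and obtains `ω t`.
Both choices may depend on the answers obtained before time `t`, and on nothing else. -/
structure LocalStrategy (Q A : Type*) (N : ℕ) where
  copy : (Fin N → A) → Equiv.Perm (Fin N)
  question : (Fin N → A) → Fin N → Q
  causal : ∀ (ω ω' : Fin N → A) (t : Fin N), (∀ s, s < t → ω s = ω' s) →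
    copy ω t = copy ω' t ∧ question ω t = question ω' t

/-- Probability that Alice, following `a`, obtains the answers `ωA` and Bob, following `b`,
obtains the answers `ωB` (each list in that party's own order of use) from `N` independent
copies of the box `P`. -/
def jointProb {Q A : Type*} (P : Box Q A) {N : ℕ} (a b : LocalStrategy Q A N)
    (ωA ωB : Fin N → A) : ℝ :=
  ∏ i : Fin N,
    P (a.question ωA ((a.copy ωA).symm i)) (b.question ωB ((b.copy ωB).symm i))
      (ωA ((a.copy ωA).symm i)) (ωB ((b.copy ωB).symm i))

/-- A protocol with shared randomness, shared copies of a box, and one bit of communication,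
from Bob (who holds `m` bits) to Alice (who holds `n` bits and has to output a bit).
Bob uses his halves of the copies and sends one bit; Alice uses her halves, possibly
depending on the bit received, and outputs a bit. -/
structure Protocol (Q A : Type*) (n m : ℕ) where
  /-- number of copies of the box -/
  copies : ℕ
  /-- number of values of the shared random variable -/
  seeds : ℕ
  /-- distribution of the shared random variable -/
  weight : Fin seeds → ℝ
  weight_nonneg : ∀ r, 0 ≤ weight r
  weight_sum : ∑ r, weight r = 1
  bob : Fin seeds → (Fin m → Bool) → LocalStrategy Q A copies
  message : Fin seeds → (Fin m → Bool) → (Fin copies → A) → Bool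
  alice : Fin seeds → (Fin n → Bool) → Bool → LocalStrategy Q A copies
  output : Fin seeds → (Fin n → Bool) → Bool → (Fin copies → A) → Bool

/-- Probability that Alice outputs `z` on inputs `X`, `Y`, when the box shared is `P`. -/
noncomputable def Protocol.outputProb {Q A : Type*} [Fintype A] {n m : ℕ}
    (π : Protocol Q A n m) (P : Box Q A) (X : Fin n → Bool) (Y : Fin m → Bool) (z : Bool) : ℝ :=
  ∑ r, π.weight r * ∑ ωA : Fin π.copies → A, ∑ ωB : Fin π.copies → A,
    if π.output r X (π.message r Y ωB) ωA = z then
      jointProb P (π.alice r X (π.message r Y ωB)) (π.bob r Y) ωA ωB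
    else 0

/-- The box `P` collapses communication complexity: for some `p > 1/2`, every Boolean function
of two bit strings, of any lengths, can be computed with success probability at least `p` on
every input, by a protocol with one bit of communication, shared randomness and finitely many
copies of `P`. -/
def CollapsesCC {Q A : Type*} [Fintype A] (P : Box Q A) : Prop :=
  ∃ p : ℝ, 1 / 2 < p ∧
    ∀ (n m : ℕ) (f : (Fin n → Bool) → (Fin m → Bool) → Bool),
      ∃ π : Protocol Q A n m, ∀ X Y, p ≤ π.outputProb P X Y (f X Y)

/-! ### The graph isomorphism game -/

section Game

variable {VG VH : Type*}

/-- One of `x`, `y` is the vertex `g` of the first graph and the other one is the vertex `h`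
of the second graph. -/
def Pairs (x y : VG ⊕ VH) (g : VG) (h : VH) : Prop :=
  (x = Sum.inl g ∧ y = Sum.inr h) ∨ (x = Sum.inr h ∧ y = Sum.inl g)

/-- The winning condition of the isomorphism game, with questions `xA`, `xB` and answers
`yA`, `yB`. -/
def Wins (G : SimpleGraph VG) (H : SimpleGraph VH) (xA xB yA yB : VG ⊕ VH) : Prop :=
  ∃ gA hA gB hB, Pairs xA yA gA hA ∧ Pairs xB yB gB hB ∧
    (gA = gB ↔ hA = hB) ∧
    (G.Adj gA gB ↔ H.Adj hA hB) ∧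
    ((gA ≠ gB ∧ ¬ G.Adj gA gB) ↔ (hA ≠ hB ∧ ¬ H.Adj hA hB))

/-- `P` is a perfect non-signalling strategy for the isomorphism game of `(G, H)`. -/
structure IsPerfectNSStrategy [Fintype VG] [Fintype VH]
    (G : SimpleGraph VG) (H : SimpleGraph VH) (P : Box (VG ⊕ VH) (VG ⊕ VH)) : Prop where
  nonSignalling : IsNonSignalling P
  perfect : ∀ xA xB yA yB, ¬ Wins G H xA xB yA yB → P xA xB yA yB = 0

/-- `G ≅_ns H`. -/
def NSIsomorphic [Fintype VG] [Fintype VH] (G : SimpleGraph VG) (H : SimpleGraph VH) : Prop :=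
  ∃ P : Box (VG ⊕ VH) (VG ⊕ VH), IsPerfectNSStrategy G H P

end Game

/-! ### Graph notions -/

section Graphs

variable {V W : Type*}

/-- The largest distance between two vertices in a common connected component
(`SimpleGraph.dist` is `0` for vertices in different components). -/
noncomputable def finiteDiam [Fintype V] (G : SimpleGraph V) : ℕ :=
  Finset.univ.sup fun q : V × V => G.dist q.1 q.2

/-- `H = H₁ ⊔ H₂` is a decomposition of `H` in two nonempty parts without edges between them. -/
structure IsDecomposition (H : SimpleGraph V) (H₁ H₂ : Finset V) : Prop where
  nonempty_left : H₁.Nonempty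
  nonempty_right : H₂.Nonempty
  mem_right_iff : ∀ v, v ∈ H₂ ↔ v ∉ H₁
  not_adj : ∀ v ∈ H₁, ∀ w ∈ H₂, ¬ H.Adj v w

/-- The (nonempty) fibres of `col` form an equitable partition of `G`, with parameters `c`. -/
structure IsEquitable [Fintype V] (G : SimpleGraph V) [DecidableRel G.Adj] {k : ℕ}
    (col : V → Fin k) (c : Fin k → Fin k → ℕ) : Prop where
  surjective : Function.Surjective col
  card_neighbors : ∀ v j, (Finset.univ.filter fun w => G.Adj v w ∧ col w = j).card = c (col v) j

/-- The partitions `C i = colG ⁻¹ {i}` of `G` and `D i = colH ⁻¹ {i}` of `H` form a common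
equitable partition. -/
def IsCommonEquitablePartition [Fintype V] [Fintype W]
    (G : SimpleGraph V) [DecidableRel G.Adj] (H : SimpleGraph W) [DecidableRel H.Adj] {k : ℕ}
    (colG : V → Fin k) (colH : W → Fin k) : Prop :=
  (∃ c : Fin k → Fin k → ℕ, IsEquitable G colG c ∧ IsEquitable H colH c) ∧
    ∀ i, (Finset.univ.filter fun v => colG v = i).card =
      (Finset.univ.filter fun w => colH w = i).card

/-- The proportion `|D i ∩ H₁| / |D i|`, where `D i = col ⁻¹ {i}`. -/
def proportion [Fintype V] {k : ℕ} (col : V → Fin k) (H₁ : Finset V) (i : Fin k) : ℚ :=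
  ((H₁.filter fun v => col v = i).card : ℚ) / ((Finset.univ.filter fun v => col v = i).card : ℚ)

/-- Strong transitivity of a finite graph. -/
def StronglyTransitive (H : SimpleGraph V) : Prop :=
  ∃ S : Set (H ≃g H),
    (∃ d₁ : ℕ, 1 ≤ d₁ ∧ ∀ h h' : V, {φ ∈ S | φ h = h'}.ncard = d₁) ∧
    (∃ d₂ : ℕ, 1 ≤ d₂ ∧ ∀ h₁ h₂ h₁' h₂' : V, H.Adj h₁ h₂ → H.Adj h₁' h₂' →
      {φ ∈ S | φ h₁ = h₁' ∧ φ h₂ = h₂'}.ncard = d₂) ∧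
    (∃ d₃ : ℕ, 1 ≤ d₃ ∧ ∀ h₁ h₂ h₁' h₂' : V, Hᶜ.Adj h₁ h₂ → Hᶜ.Adj h₁' h₂' →
      {φ ∈ S | φ h₁ = h₁' ∧ φ h₂ = h₂'}.ncard = d₃)

end Graphs

end GraphIsoGame

namespace GraphIsoGame

/-! An induced path `a - b - c` of `G` turns any perfect strategy into a noisy PR box with one-sided
error. Alice asks `b` or `a`, Bob asks `b` or `c`. Unless `a` meets `c`, the answers are equal or
adjacent vertices of `H`, hence on the same side of the decomposition, even after an automorphism.
If `a` meets `c`, they are distinct and non-adjacent, and by `exists_iso_separating` a uniformly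
random automorphism separates them with positive probability.

To compute `f`, run `T` copies for each possible input `Z` of Alice: she may ask `a` only if `Z =
X`, Bob may ask `c` only if `f Z Y` holds. The parties' total parities should then differ exactly
when `f X Y` holds. So that a difference, once created, is never undone, a party asks the
alternative question only when the running parity equals a fresh shared bit `r`; parties with
different parities cannot both match `r`. Thus the error is zero if `f X Y` is false and at most `(1
- κ) ^ T` otherwise, whatever `n` and `m` are. -/

/-! ### A supermartingale inequality -/

/-- Iterated conditional bound for an additive process: the increments `δ (ω i)` are drawn with
weights `K i` depending on the current position. -/
theorem sum_prod_mul_le {Ω M : Type*} [Fintype Ω] [AddCommMonoid M] (δ : Ω → M) (F : M → ℝ) :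
    ∀ (N : ℕ) (K : Fin N → M → Ω → ℝ) (c : Fin N → ℝ), (∀ i s o, 0 ≤ K i s o) → (∀ i, 0 ≤ c i) →
      (∀ i s, ∑ o, K i s o * F (s + δ o) ≤ c i * F s) →
      ∑ ω : Fin N → Ω, (∏ i, K i (∑ s, if s < i then δ (ω s) else 0) (ω i)) * F (∑ s, δ (ω s))
        ≤ (∏ i, c i) * F 0 := by
  intro N
  induction N with
  | zero => intro K c _ _ _; simp
  | succ N ih =>
    intro K c hK hc h
    -- The last increment is summed first, since no earlier weight depends on it.
    rw [← Equiv.sum_comp (Fin.snocEquiv fun _ => Ω), Fintype.sum_prod_type, Finset.sum_comm]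
    have key : ∀ ω : Fin N → Ω,
        ∑ o, (∏ i, K i (∑ s, if s < i then δ (Fin.snocEquiv (fun _ => Ω) (o, ω) s) else 0)
            (Fin.snocEquiv (fun _ => Ω) (o, ω) i)) *
              F (∑ s, δ (Fin.snocEquiv (fun _ => Ω) (o, ω) s)) ≤
          c (Fin.last N) * ((∏ i : Fin N, K i.castSucc (∑ s, if s < i then δ (ω s) else 0) (ω i)) *
            F (∑ s, δ (ω s))) := by
      intro ω
      have hW : 0 ≤ ∏ i : Fin N, K i.castSucc (∑ s, if s < i then δ (ω s) else 0) (ω i) :=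
        Finset.prod_nonneg fun i _ => hK _ _ _
      have := mul_le_mul_of_nonneg_left (h (Fin.last N) (∑ s, δ (ω s))) hW
      rw [Finset.mul_sum] at this
      refine le_of_eq_of_le (Finset.sum_congr rfl fun o _ => ?_) (this.trans_eq (by ring))
      have hnot : ∀ i : Fin N, ¬ Fin.last N < i.castSucc := fun i => (Fin.le_last _).not_gt
      simp [Fin.prod_univ_castSucc, Fin.sum_univ_castSucc, Fin.snocEquiv, Fin.castSucc_lt_last,
        hnot, mul_assoc]
    refine (Finset.sum_le_sum fun ω _ => key ω).trans ?_
    rw [← Finset.mul_sum, Fin.prod_univ_castSucc, mul_comm (∏ i : Fin N, c i.castSucc), mul_assoc]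
    exact mul_le_mul_of_nonneg_left
      (ih (fun i => K i.castSucc) (fun i => c i.castSucc) (fun _ => hK _) (fun _ => hc _)
        fun i => h i.castSucc) (hc _)

/-- The strategy which uses the copies in their given order, and chooses each question from the
sum of the bits extracted from the earlier answers. -/
def paritySumStrategy {Q A : Type*} {N : ℕ} (τ : Fin N → A → ZMod 2) (q : Fin N → ZMod 2 → Q) :
    LocalStrategy Q A N where
  copy _ := 1
  question ω t := q t (∑ s, if s < t then τ s (ω s) else 0)
  causal ω ω' t h := by
    refine ⟨rfl, congrArg (q t) (Finset.sum_congr rfl fun s _ => ?_)⟩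
    split_ifs with hs
    · rw [h s hs]
    · rfl

/-! ### The effect of one copy on the two parities -/

section

variable {Q A Φ : Type*} [Fintype A] [Fintype Φ]

/-- Weight of the shared random pair `(φ, r)` together with the answers `yA`, `yB`, when the two
parties have the running parities `s.1`, `s.2`; a party asks her alternative question if she is
allowed to (`x`, resp. `y`) and her parity is `r`. -/
noncomputable def stepWeight (P : Box Q A) (u v : Bool → Q) (x y : Bool) (s : ZMod 2 × ZMod 2)
    (o : (Φ × ZMod 2) × A × A) : ℝ :=
  (Fintype.card (Φ × ZMod 2) : ℝ)⁻¹ *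
    P (u (x && decide (s.1 = o.1.2))) (v (y && decide (s.2 = o.1.2))) o.2.1 o.2.2

/-- The bits extracted from the answers. -/
def stepBits (τ : Φ → A → ZMod 2) (o : (Φ × ZMod 2) × A × A) : ZMod 2 × ZMod 2 :=
  (τ o.1.1 o.2.1, τ o.1.1 o.2.2)

theorem stepWeight_nonneg {P : Box Q A} (hP : IsNonSignalling P) (u v : Bool → Q) (x y : Bool)
    (s : ZMod 2 × ZMod 2) (o : (Φ × ZMod 2) × A × A) : 0 ≤ stepWeight P u v x y s o :=
  mul_nonneg (by positivity) (hP.nonneg _ _ _ _)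

theorem sum_stepWeight [Nonempty Φ] {P : Box Q A} (hP : IsNonSignalling P) (u v : Bool → Q)
    (x y : Bool) (s : ZMod 2 × ZMod 2) :
    ∑ o : (Φ × ZMod 2) × A × A, stepWeight P u v x y s o = 1 := by
  have hρ : ∀ ρ : Φ × ZMod 2, ∑ p : A × A, stepWeight P u v x y s (ρ, p) =
      (Fintype.card (Φ × ZMod 2) : ℝ)⁻¹ := fun ρ => by
    simp only [stepWeight, ← Finset.mul_sum]
    rw [Fintype.sum_prod_type]
    exact (congrArg _ (hP.sum_eq_one (u (x && decide (s.1 = ρ.2)))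
      (v (y && decide (s.2 = ρ.2))))).trans (mul_one _)
  rw [Fintype.sum_prod_type, Finset.sum_congr rfl fun ρ _ => hρ ρ, Finset.sum_const,
    Finset.card_univ, nsmul_eq_mul]
  exact mul_inv_cancel₀ (by positivity)

/-- The indicator function of the pairs of parities whose sum is `z`. -/
def sumIndicator (z : ZMod 2) (s : ZMod 2 × ZMod 2) : ℝ := if s.1 + s.2 = z then 1 else 0

theorem sumIndicator_zero_add_one (s : ZMod 2 × ZMod 2) :
    sumIndicator 0 s + sumIndicator 1 s = 1 := by
  unfold sumIndicator
  rcases (by decide : ∀ a : ZMod 2, a = 0 ∨ a = 1) (s.1 + s.2) with h | h <;> simp [h]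

theorem sumIndicator_add_self (z : ZMod 2) (s : ZMod 2 × ZMod 2) (a : ZMod 2) :
    sumIndicator z (s + (a, a)) = sumIndicator z s := by
  have : s.1 + a + (s.2 + a) = s.1 + s.2 := by
    linear_combination CharTwo.add_self_eq_zero a
  simp [sumIndicator, this]

variable {P : Box Q A} {u v : Bool → Q} {τ : Φ → A → ZMod 2}

/-- The sum of the parities does not change if the two parties never both ask their alternative
question. -/
theorem sum_stepWeight_mul_sumIndicator_eq [Nonempty Φ] (hP : IsNonSignalling P)
    (heq : ∀ x y, (x && y) = false → ∀ φ yA yB, P (u x) (v y) yA yB ≠ 0 → τ φ yA = τ φ yB)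
    (x y : Bool) (s : ZMod 2 × ZMod 2) (h : (x && y) = false ∨ s.1 + s.2 = 1) (z : ZMod 2) :
    ∑ o, stepWeight P u v x y s o * sumIndicator z (s + stepBits τ o) = sumIndicator z s := by
  rw [← one_mul (sumIndicator z s), ← sum_stepWeight (Φ := Φ) hP u v x y s, Finset.sum_mul]
  refine Finset.sum_congr rfl fun o _ => ?_
  by_cases h0 : P (u (x && decide (s.1 = o.1.2))) (v (y && decide (s.2 = o.1.2))) o.2.1 o.2.2 = 0
  · simp [stepWeight, h0]
  · rw [stepBits, heq _ _ ?_ o.1.1 _ _ h0, sumIndicator_add_self]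
    rcases h with h | h
    · revert h; cases x <;> cases y <;> simp
    -- Different parities cannot both equal the shared bit.
    · have : ¬ (s.1 = o.1.2 ∧ s.2 = o.1.2) := by
        rintro ⟨h1, h2⟩
        rw [h1, h2, CharTwo.add_self_eq_zero] at h
        exact zero_ne_one h
      rw [← Bool.not_eq_true]
      simp only [Bool.and_eq_true, decide_eq_true_eq]
      tauto

/-- When both parties may ask their alternative question, equal parities become different with
some probability. -/
theorem sum_stepWeight_mul_sumIndicator_le [Nonempty Φ] (hP : IsNonSignalling P)
    (heq : ∀ x y, (x && y) = false → ∀ φ yA yB, P (u x) (v y) yA yB ≠ 0 → τ φ yA = τ φ yB)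
    (hne : ∀ yA yB, P (u true) (v true) yA yB ≠ 0 → ∃ φ, τ φ yA ≠ τ φ yB)
    (s : ZMod 2 × ZMod 2) :
    ∑ o, stepWeight P u v true true s o * sumIndicator 0 (s + stepBits τ o) ≤
      (1 - (Fintype.card (Φ × ZMod 2) : ℝ)⁻¹) * sumIndicator 0 s := by
  by_cases hs : s.1 + s.2 = 0
  swap
  · have h1 : s.1 + s.2 = 1 := by
      generalize s.1 + s.2 = a at hs
      revert hs; revert a; decide
    rw [sum_stepWeight_mul_sumIndicator_eq hP heq _ _ _ (Or.inr h1)]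
    simp [sumIndicator, h1]
  · obtain ⟨a, b⟩ := s
    obtain rfl : a = b := by simpa using CharTwo.add_eq_zero.1 hs
    have h1 : sumIndicator 0 (a, a) = 1 := by simp [sumIndicator, hs]
    have hle : ∀ z s, sumIndicator z s ≤ 1 := fun z s => by
      unfold sumIndicator; split_ifs <;> norm_num
    set κ : ℝ := (Fintype.card (Φ × ZMod 2) : ℝ)⁻¹ with hκ
    have hκ0 : 0 ≤ κ := by positivity
    suffices κ ≤ ∑ o : (Φ × ZMod 2) × A × A, stepWeight P u v true true (a, a) o *
        (1 - sumIndicator 0 ((a, a) + stepBits τ o)) by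
      simp only [mul_sub, mul_one, Finset.sum_sub_distrib, sum_stepWeight hP] at this
      rw [h1]; linarith
    have hnn : ∀ o : (Φ × ZMod 2) × A × A, 0 ≤ stepWeight P u v true true (a, a) o *
        (1 - sumIndicator 0 ((a, a) + stepBits τ o)) := fun o =>
      mul_nonneg (stepWeight_nonneg hP _ _ _ _ _ _) (sub_nonneg.2 (hle _ _))
    rw [Fintype.sum_prod_type, Finset.sum_comm]
    -- Spreading `κ` over the answers reduces the bound to one seed per answer pair: a separating
    -- `φ`, with shared bit `a`, the common parity, so that both alternative questions are asked.
    have hκs : κ = ∑ y : A × A, κ * P (u true) (v true) y.1 y.2 := by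
      rw [← Finset.mul_sum, Fintype.sum_prod_type, hP.sum_eq_one, mul_one]
    rw [hκs]
    refine Finset.sum_le_sum fun y _ => ?_
    by_cases h0 : P (u true) (v true) y.1 y.2 = 0
    · rw [h0, mul_zero]; exact Finset.sum_nonneg fun o _ => hnn (o, y)
    obtain ⟨φ, hφ⟩ := hne _ _ h0
    refine le_trans (le_of_eq ?_)
      (Finset.single_le_sum (fun o _ => hnn (o, y)) (Finset.mem_univ (φ, a)))
    have : sumIndicator 0 ((a, a) + stepBits τ ((φ, a), y)) = 0 := by
      refine if_neg fun h => hφ ?_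
      simpa [stepBits] using CharTwo.add_eq_zero.1 h
    rw [this]
    simp [stepWeight, hκ]

end

/-! ### The protocol and its success probability -/

/-- The protocol in which copy `t` is devoted to Alice's potential input `Z t`. -/
noncomputable def parityProtocol {Q A Φ : Type*} [Fintype Φ] [Nonempty Φ] (u v : Bool → Q)
    (τ : Φ → A → ZMod 2) {n m : ℕ} (f : (Fin n → Bool) → (Fin m → Bool) → Bool) {N : ℕ}
    (Z : Fin N → Fin n → Bool) : Protocol Q A n m where
  copies := N
  seeds := Fintype.card (Fin N → Φ × ZMod 2)
  weight _ := (Fintype.card (Fin N → Φ × ZMod 2) : ℝ)⁻¹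
  weight_nonneg _ := by positivity
  weight_sum := by
    rw [Finset.sum_const, Finset.card_univ, Fintype.card_fin, nsmul_eq_mul]
    exact mul_inv_cancel₀ (by positivity)
  bob r Y := let ρ := (Fintype.equivFin (Fin N → Φ × ZMod 2)).symm r
    paritySumStrategy (fun t => τ (ρ t).1) fun t b => v (f (Z t) Y && decide (b = (ρ t).2))
  message r _ ω := let ρ := (Fintype.equivFin (Fin N → Φ × ZMod 2)).symm r
    decide (∑ t, τ (ρ t).1 (ω t) = 1)
  alice r X _ := let ρ := (Fintype.equivFin (Fin N → Φ × ZMod 2)).symm r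
    paritySumStrategy (fun t => τ (ρ t).1) fun t a => u (decide (Z t = X) && decide (a = (ρ t).2))
  output r _ μ ω := let ρ := (Fintype.equivFin (Fin N → Φ × ZMod 2)).symm r
    xor (decide (∑ t, τ (ρ t).1 (ω t) = 1)) μ

/-- Alice's questions ignore Bob's message and both parties use the copies in the same order, so
seeds and answers can be regrouped copy by copy into one additive process. -/
theorem outputProb_parityProtocol {Q A Φ : Type*} [Fintype A] [Fintype Φ] [Nonempty Φ]
    (P : Box Q A) (u v : Bool → Q) (τ : Φ → A → ZMod 2) {n m : ℕ}
    (f : (Fin n → Bool) → (Fin m → Bool) → Bool) {N : ℕ} (Z : Fin N → Fin n → Bool)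
    (X : Fin n → Bool) (Y : Fin m → Bool) (z : Bool) :
    (parityProtocol u v τ f Z).outputProb P X Y z =
      ∑ ω : Fin N → (Φ × ZMod 2) × A × A,
        (∏ i, stepWeight P u v (decide (Z i = X)) (f (Z i) Y)
          (∑ s, if s < i then stepBits τ (ω s) else 0) (ω i)) *
          sumIndicator (if z then 1 else 0) (∑ s, stepBits τ (ω s)) := by
  rw [← Equiv.sum_comp (Equiv.arrowProdEquivProdArrow (Fin N) (fun _ => Φ × ZMod 2)
    (fun _ => A × A)).symm, Fintype.sum_prod_type,
    ← Equiv.sum_comp (Fintype.equivFin (Fin N → Φ × ZMod 2)).symm]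
  refine Finset.sum_congr rfl fun r _ => ?_
  rw [← Equiv.sum_comp (Equiv.arrowProdEquivProdArrow (Fin N) (fun _ => A) (fun _ => A)).symm,
    Fintype.sum_prod_type, Finset.mul_sum]
  refine Finset.sum_congr rfl fun ωA _ => ?_
  rw [Finset.mul_sum]
  refine Finset.sum_congr rfl fun ωB _ => ?_
  have hbit : ∀ a b : ZMod 2, (xor (decide (a = 1)) (decide (b = 1)) = z) ↔
      a + b = if z then 1 else 0 := by
    revert z; decide
  have h1 : ∀ (p : Prop) [Decidable p] (a b : ZMod 2),
      (if p then (a, b) else 0) = (if p then a else 0, if p then b else 0) := by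
    intro p _ a b; split_ifs <;> rfl
  simp only [parityProtocol, hbit, stepWeight, stepBits, sumIndicator,
    h1, Prod.fst_sum, Prod.snd_sum, Equiv.arrowProdEquivProdArrow, Equiv.coe_fn_symm_mk,
    Finset.prod_mul_distrib, Finset.prod_const, Finset.card_univ, Fintype.card_fin,
    Fintype.card_fun, Nat.cast_pow, inv_pow]
  split_ifs <;> simp <;> rfl

/-- A box whose answers are turned into equal bits unless both parties ask their alternative
question, and into different bits with positive probability if both do, collapses communication
complexity. -/
theorem collapsesCC_of_correlated_bits {Q A Φ : Type*} [Fintype A] [Fintype Φ] [Nonempty Φ]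
    {P : Box Q A} (hP : IsNonSignalling P) {u v : Bool → Q} {τ : Φ → A → ZMod 2}
    (heq : ∀ x y, (x && y) = false → ∀ φ yA yB, P (u x) (v y) yA yB ≠ 0 → τ φ yA = τ φ yB)
    (hne : ∀ yA yB, P (u true) (v true) yA yB ≠ 0 → ∃ φ, τ φ yA ≠ τ φ yB) :
    CollapsesCC P := by
  set κ : ℝ := (Fintype.card (Φ × ZMod 2) : ℝ)⁻¹ with hκ
  have hκ0 : 0 < κ := by positivity
  have hκ1 : κ ≤ 1 := inv_le_one_of_one_le₀ (by exact_mod_cast Fintype.card_pos)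
  -- `T` depends only on `κ`, which makes the success probability uniform in `n`, `m` and `f`.
  obtain ⟨T, hT⟩ := exists_pow_lt_of_lt_one (show (0 : ℝ) < 1 / 3 by norm_num)
    (show 1 - κ < 1 by linarith)
  refine ⟨2 / 3, by norm_num, fun n m f => ?_⟩
  let e := (Fintype.equivFin ((Fin n → Bool) × Fin T)).symm
  refine ⟨parityProtocol u v τ f fun t => (e t).1, fun X Y => ?_⟩
  rw [outputProb_parityProtocol]
  let K : Fin (Fintype.card ((Fin n → Bool) × Fin T)) → ZMod 2 × ZMod 2 →
      (Φ × ZMod 2) × A × A → ℝ := fun i =>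
    stepWeight P u v (decide ((e i).1 = X)) (f (e i).1 Y)
  have hK : ∀ i s o, 0 ≤ K i s o := fun i s o => stepWeight_nonneg hP _ _ _ _ _ _
  -- The constant `-1` turns the upper bound of `sum_prod_mul_le` into the lower bound `1` on the
  -- total mass.
  have hle1 : ∀ i s, ∑ o, K i s o * (fun _ => (-1 : ℝ)) (s + stepBits τ o) ≤
      (1 : ℝ) * (fun _ => (-1 : ℝ)) s := fun i s => by
    simp [K, Finset.sum_neg_distrib, sum_stepWeight hP]
  have htotal := sum_prod_mul_le (stepBits τ) (fun _ => (-1 : ℝ)) _ K (fun _ => 1) hK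
    (fun _ => zero_le_one) hle1
  have hsplit : (1 : ℝ) ≤ ∑ ω : Fin _ → _, (∏ i, K i (∑ s, if s < i then stepBits τ (ω s) else 0) (ω i)) *
        sumIndicator 0 (∑ s, stepBits τ (ω s)) +
      ∑ ω : Fin _ → _, (∏ i, K i (∑ s, if s < i then stepBits τ (ω s) else 0) (ω i)) *
        sumIndicator 1 (∑ s, stepBits τ (ω s)) := by
    simp only [← Finset.sum_add_distrib, ← mul_add, sumIndicator_zero_add_one]
    simpa using htotal
  cases hf : f X Y with
  | false =>
    have hfail := sum_prod_mul_le (stepBits τ) (sumIndicator 1) _ K (fun _ => 1) hK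
      (fun _ => zero_le_one) fun i s => by
        rw [one_mul]
        refine (sum_stepWeight_mul_sumIndicator_eq hP heq _ _ _ (Or.inl ?_) _).le
        by_cases h : (e i).1 = X
        · simp [h, hf]
        · simp [h]
    have h0 : sumIndicator 1 0 = 0 := by simp [sumIndicator]
    rw [h0, mul_zero] at hfail
    simp only [Bool.false_eq_true, if_false]
    linarith
  | true =>
    have hfail := sum_prod_mul_le (stepBits τ) (sumIndicator 0) _ K
      (fun i => if (e i).1 = X then 1 - κ else 1) hK
      (fun i => by split_ifs <;> linarith) fun i s => by
        by_cases h : (e i).1 = X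
        · simp only [K, h, hf, decide_true, if_true]
          exact sum_stepWeight_mul_sumIndicator_le hP heq hne s
        · rw [if_neg h, one_mul]
          exact (sum_stepWeight_mul_sumIndicator_eq hP heq _ _ _ (Or.inl (by simp [h])) _).le
    -- Exactly `T` copies are devoted to the actual input `X`.
    have hprod : ∏ i, (if (e i).1 = X then 1 - κ else 1) = (1 - κ) ^ T := by
      rw [Equiv.prod_comp e fun p => if p.1 = X then 1 - κ else 1, Fintype.prod_prod_type_right]
      dsimp only
      simp [Finset.prod_ite_eq']
    rw [hprod] at hfail
    simp only [if_true]
    have h0 : sumIndicator 0 0 = 1 := by simp [sumIndicator]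
    rw [h0, mul_one] at hfail
    linarith


/-! ### Induced paths and separating automorphisms -/

/-- A finite graph with two vertices at distance at least two in the same component contains an
induced path on three vertices. -/
theorem exists_induced_path {V : Type*} [Fintype V] {G : SimpleGraph V} (h : 2 ≤ finiteDiam G) :
    ∃ a b c, G.Adj a b ∧ G.Adj b c ∧ a ≠ c ∧ ¬ G.Adj a c := by
  by_contra! hcon
  -- Without an induced path, "equal or adjacent" is transitive, so every component is complete.
  have hwalk : ∀ {a b : V}, G.Walk a b → a = b ∨ G.Adj a b := by
    intro a b p
    induction p with
    | nil => exact Or.inl rfl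
    | @cons a b c hab p ih =>
      rcases ih with rfl | hbc
      · exact Or.inr hab
      · exact or_iff_not_imp_left.2 fun hac => hcon a b c hab hbc hac
  have : finiteDiam G ≤ 1 := by
    refine Finset.sup_le fun q _ => ?_
    by_cases hq : G.Reachable q.1 q.2
    · obtain ⟨p⟩ := hq
      rcases hwalk p with h | h
      · simp [h]
      · exact (SimpleGraph.dist_eq_one_iff_adj.2 h).le
    · simp [SimpleGraph.dist_eq_zero_of_not_reachable hq]
  omega

/-- In a graph whose complement is arc-transitive, automorphisms separate distinct non-adjacent
vertices into the two parts of a decomposition. -/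
theorem exists_iso_separating {V : Type*} {H : SimpleGraph V} (htrans : StronglyTransitive H)
    {H₁ H₂ : Finset V} (hdec : IsDecomposition H H₁ H₂) {h h' : V} (hne : h ≠ h')
    (hadj : ¬ H.Adj h h') : ∃ φ : H ≃g H, φ h ∈ H₁ ∧ φ h' ∉ H₁ := by
  obtain ⟨S, -, -, d₃, hd₃, hS⟩ := htrans
  obtain ⟨a, ha⟩ := hdec.nonempty_left
  obtain ⟨b, hb⟩ := hdec.nonempty_right
  have hb' := (hdec.mem_right_iff b).1 hb
  -- Both `(h, h')` and `(a, b)`, taken across the decomposition, are arcs of the complement, so `d₃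
  -- ≥ 1` gives an automorphism from one to the other.
  have hcard := hS h h' a b (by simp [hne, hadj])
    (by simpa [hdec.not_adj a ha b hb] using fun hab : a = b => hb' (hab ▸ ha))
  obtain ⟨φ, -, h₁, h₂⟩ := Set.nonempty_of_ncard_ne_zero (hcard.trans_ne (by omega))
  exact ⟨φ, h₁ ▸ ha, h₂ ▸ hb'⟩

theorem IsDecomposition.mem_left_iff_of_adj {V : Type*} {H : SimpleGraph V} {H₁ H₂ : Finset V}
    (hdec : IsDecomposition H H₁ H₂) {h h' : V} (hadj : H.Adj h h') : h ∈ H₁ ↔ h' ∈ H₁ := by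
  constructor <;> intro hm <;> by_contra hn
  · exact hdec.not_adj _ hm _ ((hdec.mem_right_iff _).2 hn) hadj
  · exact hdec.not_adj _ hm _ ((hdec.mem_right_iff _).2 hn) hadj.symm

theorem Wins.exists_of_inl {VG VH : Type*} {G : SimpleGraph VG} {H : SimpleGraph VH} {g g' : VG}
    {yA yB : VG ⊕ VH} (h : Wins G H (Sum.inl g) (Sum.inl g') yA yB) :
    ∃ hA hB, yA = Sum.inr hA ∧ yB = Sum.inr hB ∧ (g = g' ↔ hA = hB) ∧
      (G.Adj g g' ↔ H.Adj hA hB) := by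
  obtain ⟨gA, hA, gB, hB, h1, h2, h3, h4, -⟩ := h
  simp only [Pairs, Sum.inl.injEq, reduceCtorEq, false_and, or_false] at h1 h2
  obtain ⟨rfl, rfl⟩ := h1
  obtain ⟨rfl, rfl⟩ := h2
  exact ⟨hA, hB, rfl, rfl, h3, h4⟩

/-- The bit telling on which side of a decomposition an answer lies, after an automorphism. -/
def sideBit {VG VH : Type*} [DecidableEq VH] {H : SimpleGraph VH} (H₁ : Finset VH) (φ : H ≃g H) :
    VG ⊕ VH → ZMod 2 :=
  Sum.elim (fun _ => 0) fun h => if φ h ∈ H₁ then 1 else 0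

end GraphIsoGame

theorem mainTheorem1 {VG VH : Type*} [Fintype VG] [Fintype VH]
    (G : SimpleGraph VG) [DecidableRel G.Adj] (H : SimpleGraph VH) [DecidableRel H.Adj]
    (hGH : GraphIsoGame.NSIsomorphic G H)
    (hdiam : 2 ≤ GraphIsoGame.finiteDiam G)
    (H₁ H₂ : Finset VH) (hdec : GraphIsoGame.IsDecomposition H H₁ H₂)
    (k : ℕ) (colG : VG → Fin k) (colH : VH → Fin k)
    (hpart : GraphIsoGame.IsCommonEquitablePartition G H colG colH)
    (hprop : ∀ i j : Fin k,
      GraphIsoGame.proportion colH H₁ i = GraphIsoGame.proportion colH H₁ j)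
    (htrans : GraphIsoGame.StronglyTransitive H)
    (d : ℕ) (hreg : H.IsRegularOfDegree d) :
    ∀ P : GraphIsoGame.Box (VG ⊕ VH) (VG ⊕ VH),
      GraphIsoGame.IsPerfectNSStrategy G H P → GraphIsoGame.CollapsesCC P := by
  classical
  intro P hP
  obtain ⟨a, b, c, hab, hbc, hac, hac'⟩ := GraphIsoGame.exists_induced_path hdiam
  have : Finite (H ≃g H) := DFunLike.finite _
  have := Fintype.ofFinite (H ≃g H)
  have : Nonempty (H ≃g H) := ⟨RelIso.refl _⟩
  have hwin : ∀ {g g' : VG} {yA yB}, P (Sum.inl g) (Sum.inl g') yA yB ≠ 0 →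
      ∃ hA hB, yA = Sum.inr hA ∧ yB = Sum.inr hB ∧ (g = g' ↔ hA = hB) ∧
        (G.Adj g g' ↔ H.Adj hA hB) := fun h =>
    GraphIsoGame.Wins.exists_of_inl (not_imp_comm.1 (hP.perfect _ _ _ _) h)
  refine GraphIsoGame.collapsesCC_of_correlated_bits hP.nonSignalling
    (u := fun x => Sum.inl (if x then a else b)) (v := fun y => Sum.inl (if y then c else b))
    (τ := GraphIsoGame.sideBit (VG := VG) (H := H) H₁) ?_ ?_
  · intro x y hxy φ yA yB h
    obtain ⟨hA, hB, rfl, rfl, heq, hadj⟩ := hwin h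
    have : hA = hB ∨ H.Adj hA hB := by
      rw [← heq, ← hadj]
      revert hxy; cases x <;> cases y <;> simp [hab, hbc]
    rcases this with rfl | h
    · rfl
    · simp [GraphIsoGame.sideBit, hdec.mem_left_iff_of_adj (φ.map_adj_iff.2 h)]
  · intro yA yB h
    obtain ⟨hA, hB, rfl, rfl, heq, hadj⟩ := hwin h
    simp only [if_true] at heq hadj
    obtain ⟨φ, h₁, h₂⟩ := GraphIsoGame.exists_iso_separating htrans hdec (mt heq.2 hac)
      (mt hadj.2 hac')
    exact ⟨φ, by simp [GraphIsoGame.sideBit, h₁, h₂]⟩
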